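/- For integers $K$ and $l\ge 0$ let $C_l^{(K)}$ denote the number of lattice paths with steps $(1,1)$ and $(1,-1)$ from $(0,0)$ to $(l,0)$ that never pass below the $x$-axis and never pass above the horizontal line $y=K$. Let $n,k,m$ be non-negative integers and put $K=2k+2m-1$. Then there is exactly one extension of the sequence $(C_l^{(K)})_{l\ge 0}$ to a sequence of rational numbers $(C_l^{(K)})_{l\in\mathbb Z}$ that satisfies, on all of $\mathbb Z$, a linear recurrence with constant coefficients $\sum_{i=0}^{d} q_i\,C_{l+i}^{(K)}=0$ with $q_0\ne 0$ and $q_d\neq 0$ (that is, negative-index values are obtained by running the linear recurrence of the sequence backwards). With the values of this extended sequence, $$ \det\left(C_{2n+2i+2j+4m-2}^{(2k+2m-1)}\right)_{0\le i,j\le k-1} = \det\left(C_{-2n-2i-2j}^{(2k+2m-1)}\right)_{0\le i,j\le m-1}, $$ where the determinant of an empty ($0\times 0$) matrix is $1$. -/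

import Mathlib

/-- Up-down paths of length `n` (steps `(1,1)` and `(1,-1)`) from `(0,r)` to `(n,s)` which do not
pass below the `x`-axis and do not pass above the line `y = K`, given by their heights
`h 0, h 1, …, h n` at the abscissas `0, 1, …, n`. -/
def boundedPaths (K r s : ℤ) (n : ℕ) : Set (Fin (n + 1) → ℤ) :=
  {h | h 0 = r ∧ h (Fin.last n) = s ∧
    (∀ i : Fin n, h i.succ = h i.castSucc + 1 ∨ h i.succ = h i.castSucc - 1) ∧
    ∀ i, 0 ≤ h i ∧ h i ≤ K}

/-- The number of bounded Dyck paths of length `n`: up-down paths from `(0,0)` to `(n,0)` that stay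
between the `x`-axis and the line `y = K`. -/
noncomputable def dyckCount (K : ℤ) (n : ℕ) : ℕ := (boundedPaths K 0 0 n).ncard

/-- The two-sided sequence `c` extends the sequence `a` to negative indices by a linear recurrence
with constant coefficients: `c` agrees with `a` on the non-negative integers, and a relation
`q 0 * c z + q 1 * c (z + 1) + ⋯ + q d * c (z + d) = 0` with `q 0 ≠ 0` and `q d ≠ 0` holds for
all integers `z`. (As `q 0 ≠ 0`, the relation can be solved for `c z`, i.e. run backwards.) -/
def IsRecurrentExtension (a : ℕ → ℚ) (c : ℤ → ℚ) : Prop :=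
  (∀ n : ℕ, c n = a n) ∧
    ∃ (d : ℕ) (q : ℕ → ℚ), q 0 ≠ 0 ∧ q d ≠ 0 ∧
      ∀ z : ℤ, ∑ i ∈ Finset.range (d + 1), q i * c (z + i) = 0

/-!
Put `N = k + m` and let `A` be the adjacency matrix of the path graph on the heights
`0, 1, …, 2N - 1`. The number of bounded paths of length `l` is the entry of `A ^ l` at the
vertex `0`, and as `A` is invertible, the extended sequence is given by the integer powers of `A`
(`isRecurrentExtension_zpow`, `IsRecurrentExtension.unique`).

With respect to the parity of heights, `A` has the off-diagonal blocks `L` and `Lᵀ`, where `L` is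
lower bidiagonal with ones. Hence `A ^ 2` has the diagonal blocks `B = L Lᵀ` and `B' = Lᵀ L`, and
`C (2 z) = (B ^ z)₀₀`. Three facts give the reciprocity:

* `(B ^ (z + 1))₀₀ = (B' ^ z)₀₀`, since `B ^ z L = L B' ^ z` and the first row of `L` is a unit
  vector (`evenGram_zpow_add_one`);
* `B` and `B'` are tridiagonal with ones next to the diagonal, so that the `k × k` determinant of
  the entries `(B ^ (p + i + j))₀₀` is the leading principal `k × k` minor of `B ^ p`, and similarly
  for `B'` (`det_hankel_zpow`);
* `B'` is `B` with the order of the basis reversed, so that the leading `m × m` minor of `B' ^ (-p)`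
  is the trailing one of `B ^ (-p)`. As `det B = 1`, Jacobi's identity equates it with the leading
  `k × k` minor of `B ^ p` (`det_castLE_minor_evenGram`).

With `p = n + 2m - 1`, the left-hand side is the leading `k × k` minor of `B ^ p`. After its rows and
columns are reversed, the right-hand side is the determinant of the entries
`(B' ^ (-p + i + j))₀₀`, that is, the leading `m × m` minor of `B' ^ (-p)`.
-/

/-! ### Bounded paths as powers of a matrix -/

lemma boundedPaths_finite (K r s : ℤ) (n : ℕ) : (boundedPaths K r s n).Finite :=
  (Set.Finite.pi' fun _ => Set.finite_Icc (0 : ℤ) K).subset fun _ hh i => hh.2.2.2 i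

lemma boundedPaths_eq_empty {K r : ℤ} (hr : ¬ (0 ≤ r ∧ r ≤ K)) (s : ℤ) (n : ℕ) :
    boundedPaths K r s n = ∅ := by
  ext h
  simp only [Set.mem_empty_iff_false, iff_false]
  intro hh
  exact hr (hh.1 ▸ hh.2.2.2 0)

lemma ncard_boundedPaths_zero {K r : ℤ} (hr : 0 ≤ r ∧ r ≤ K) (s : ℤ) :
    (boundedPaths K r s 0).ncard = if r = s then 1 else 0 := by
  split_ifs with hrs
  · rw [Set.ncard_eq_one]
    refine ⟨fun _ => r, ?_⟩
    ext h
    simp only [boundedPaths, Set.mem_ofPred_eq, Set.mem_singleton_iff]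
    constructor
    · rintro ⟨h0, -⟩
      funext i
      obtain rfl : i = 0 := Fin.ext (by omega)
      exact h0
    · rintro rfl
      exact ⟨rfl, hrs, fun i => i.elim0, fun _ => hr⟩
  · have : boundedPaths K r s 0 = ∅ := by
      ext h
      simp only [Set.mem_empty_iff_false, iff_false]
      intro hh
      exact hrs (hh.1.symm.trans hh.2.1)
    rw [this, Set.ncard_empty]

lemma boundedPaths_succ {K r : ℤ} (hr : 0 ≤ r ∧ r ≤ K) (s : ℤ) (n : ℕ) :
    boundedPaths K r s (n + 1) =
      Fin.cons (α := fun _ => ℤ) r '' (boundedPaths K (r + 1) s n ∪ boundedPaths K (r - 1) s n) := by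
  ext h
  constructor
  · rintro ⟨h0, hl, hs, hb⟩
    refine ⟨Fin.tail h, ?_, by rw [← h0]; exact Fin.cons_self_tail h⟩
    have htail : ∀ r', h (Fin.succ 0) = r' → Fin.tail h ∈ boundedPaths K r' s n := fun r' hr' =>
      ⟨hr', hl, fun i => hs i.succ, fun i => hb i.succ⟩
    rcases hs 0 with h1 | h1
    · exact Or.inl (htail _ (by rw [h1, Fin.castSucc_zero, h0]))
    · exact Or.inr (htail _ (by rw [h1, Fin.castSucc_zero, h0]))
  · rintro ⟨g, hg, rfl⟩
    have hg' : (g 0 = r + 1 ∨ g 0 = r - 1) ∧ g (Fin.last n) = s ∧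
        (∀ i : Fin n, g i.succ = g i.castSucc + 1 ∨ g i.succ = g i.castSucc - 1) ∧
        ∀ i, 0 ≤ g i ∧ g i ≤ K := by
      rcases hg with ⟨h0, h⟩ | ⟨h0, h⟩
      exacts [⟨Or.inl h0, h⟩, ⟨Or.inr h0, h⟩]
    obtain ⟨h0, hl, hs, hb⟩ := hg'
    refine ⟨rfl, hl, fun i => ?_, fun i => ?_⟩
    · refine Fin.cases ?_ (fun i => ?_) i
      · simpa using h0
      · simpa [← Fin.succ_castSucc] using hs i
    · refine Fin.cases ?_ (fun i => ?_) i
      · simpa using hr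
      · simpa using hb i

lemma ncard_boundedPaths_succ {K r : ℤ} (hr : 0 ≤ r ∧ r ≤ K) (s : ℤ) (n : ℕ) :
    (boundedPaths K r s (n + 1)).ncard =
      (boundedPaths K (r + 1) s n).ncard + (boundedPaths K (r - 1) s n).ncard := by
  rw [boundedPaths_succ hr, Set.ncard_image_of_injective _ (Fin.cons_right_injective _),
    Set.ncard_union_eq _ (boundedPaths_finite ..) (boundedPaths_finite ..)]
  refine Set.disjoint_left.2 fun g hg hg' => ?_
  have h1 := hg.1
  have h2 := hg'.1
  omega

/-- The `N × N` lower bidiagonal matrix with ones on the diagonal and just below it. Its rows stand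
for the even heights `2a`, its columns for the odd heights `2b + 1`, and its entry records whether
the two heights are adjacent. -/
def bidiag (N : ℕ) : Matrix (Fin N) (Fin N) ℚ :=
  Matrix.of fun a b => if a = b ∨ (a : ℕ) = b + 1 then 1 else 0

/-- The adjacency matrix of the path `0 - 1 - ⋯ - (2N - 1)`, with the vertex `2a` indexed by
`Sum.inl a` and the vertex `2a + 1` by `Sum.inr a`. -/
def pathAdj (N : ℕ) : Matrix (Fin N ⊕ Fin N) (Fin N ⊕ Fin N) ℚ :=
  Matrix.fromBlocks 0 (bidiag N) (bidiag N).transpose 0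

/-- The height of the vertex of the path graph that is indexed by an element of
`Fin N ⊕ Fin N`. -/
def height {N : ℕ} : Fin N ⊕ Fin N → ℤ :=
  Sum.elim (fun a => 2 * (a : ℕ)) (fun a => 2 * (a : ℕ) + 1)

lemma bidiag_eq_add {N : ℕ} (a b : Fin N) :
    bidiag N a b = (if a = b then 1 else 0) + if (a : ℕ) = b + 1 then 1 else 0 := by
  simp only [bidiag, Matrix.of_apply]
  by_cases h : a = b
  · simp [h]
  · simp [h]

lemma sum_bidiag_mul {N : ℕ} (a : Fin N) (g : ℤ → ℚ) (hg : g (-1) = 0) :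
    ∑ b, bidiag N a b * g (2 * (b : ℕ) + 1) = g (2 * (a : ℕ) + 1) + g (2 * (a : ℕ) - 1) := by
  simp only [bidiag_eq_add, add_mul, Finset.sum_add_distrib, ite_mul, one_mul, zero_mul]
  congr 1
  · simp
  · rcases Nat.eq_zero_or_pos a with h | h
    · simp [h, hg]
    · have : ∀ b : Fin N, ((a : ℕ) = b + 1 ↔ b = ⟨a - 1, by omega⟩) := fun b => by
        rw [Fin.ext_iff]; simp only; omega
      simp only [this, Finset.sum_ite_eq', Finset.mem_univ, if_true]
      congr 1
      push_cast [Nat.cast_sub h]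
      ring

lemma sum_bidiag_transpose_mul {N : ℕ} (a : Fin N) (g : ℤ → ℚ) (hg : g (2 * N) = 0) :
    ∑ b, bidiag N b a * g (2 * (b : ℕ)) = g (2 * (a : ℕ) + 2) + g (2 * (a : ℕ)) := by
  simp only [bidiag_eq_add, add_mul, Finset.sum_add_distrib, ite_mul, one_mul, zero_mul]
  rw [add_comm]
  congr 1
  · rcases Nat.lt_or_ge (a + 1) N with h | h
    · have : ∀ b : Fin N, ((b : ℕ) = a + 1 ↔ b = ⟨a + 1, h⟩) := fun b => by
        rw [Fin.ext_iff]
      simp only [this, Finset.sum_ite_eq', Finset.mem_univ, if_true]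
      congr 1
    · have hN : N = a + 1 := by omega
      have h2 : (2 * (a : ℕ) + 2 : ℤ) = 2 * N := by omega
      rw [h2, hg]
      refine Finset.sum_eq_zero fun b _ => if_neg ?_
      omega
  · simp

/-- Entries of powers of the adjacency matrix count bounded paths. -/
lemma pathAdj_pow_apply {N : ℕ} (l : ℕ) (x y : Fin N ⊕ Fin N) :
    (pathAdj N ^ l) x y = (boundedPaths (2 * N - 1) (height x) (height y) l).ncard := by
  have hb : ∀ x : Fin N ⊕ Fin N, 0 ≤ height x ∧ height x ≤ 2 * N - 1 := by
    rintro (a | a) <;> simp only [height, Sum.elim_inl, Sum.elim_inr] <;> omega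
  induction l generalizing x with
  | zero =>
    have hinj : ∀ x y : Fin N ⊕ Fin N, height x = height y ↔ x = y := by
      rintro (a | a) (b | b) <;>
        simp only [height, Sum.elim_inl, Sum.elim_inr, Sum.inl.injEq, Sum.inr.injEq, reduceCtorEq,
          iff_false, Fin.ext_iff] <;> omega
    rw [ncard_boundedPaths_zero (hb x), pow_zero, Matrix.one_apply]
    simp [hinj]
  | succ l ih =>
    rw [ncard_boundedPaths_succ (hb x), pow_succ', Matrix.mul_apply, Fintype.sum_sum_type]
    simp only [ih]
    set g : ℤ → ℚ := fun r => ((boundedPaths (2 * N - 1) r (height y) l).ncard : ℚ) with hg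
    have h1 : g (-1) = 0 := by
      simp [hg, boundedPaths_eq_empty (show ¬ ((0 : ℤ) ≤ -1 ∧ (-1 : ℤ) ≤ 2 * N - 1) by omega)]
    have h2 : g (2 * N) = 0 := by
      simp [hg, boundedPaths_eq_empty
        (show ¬ ((0 : ℤ) ≤ 2 * N ∧ (2 * N : ℤ) ≤ 2 * N - 1) by omega)]
    push_cast
    rcases x with a | a
    · simpa [pathAdj, height, hg] using sum_bidiag_mul a g h1
    · have h3 : (2 * (a : ℕ) + 1 + 1 : ℤ) = 2 * (a : ℕ) + 2 := by ring
      simpa [pathAdj, height, hg, h3] using sum_bidiag_transpose_mul a g h2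

/-! ### Two-sided recurrent sequences -/

/-- A two-sided recurrent sequence that vanishes on the non-negative integers is zero. -/
lemma eq_zero_of_recurrence {d : ℕ} {q : ℕ → ℚ} (hq : q 0 ≠ 0) {f : ℤ → ℚ}
    (hf : ∀ z, ∑ i ∈ Finset.range (d + 1), q i * f (z + i) = 0) (h0 : ∀ n : ℕ, f n = 0) :
    f = 0 := by
  have key : ∀ n : ℕ, ∀ z : ℤ, -n ≤ z → f z = 0 := by
    intro n
    induction n with
    | zero =>
      intro z hz
      lift z to ℕ using by simpa using hz
      exact h0 z
    | succ n ih =>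
      intro z hz
      have h := hf z
      rw [Finset.sum_range_succ', Finset.sum_eq_zero fun i _ => by
        rw [ih _ (by push_cast at hz ⊢; omega), mul_zero]] at h
      simpa [hq] using h
  funext z
  exact key z.natAbs z (by omega)

lemma IsRecurrentExtension.unique {a : ℕ → ℚ} {c c' : ℤ → ℚ} (hc : IsRecurrentExtension a c)
    (hc' : IsRecurrentExtension a c') : c = c' := by
  obtain ⟨hca, d, q, hq, -, hrec⟩ := hc
  obtain ⟨hca', d', q', hq', -, hrec'⟩ := hc'
  -- Applying the recurrence of `c'` to `c - c'` leaves a sequence that satisfies the recurrence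
  -- of `c` and vanishes on the non-negative integers.
  have hf : (fun z : ℤ => ∑ i ∈ Finset.range (d' + 1), q' i * c (z + i)) = 0 := by
    refine eq_zero_of_recurrence (d := d) hq (fun z => ?_) fun n => ?_
    · simp only [Finset.mul_sum]
      rw [Finset.sum_comm]
      refine Finset.sum_eq_zero fun j _ => ?_
      have h := congrArg (q' j * ·) (hrec (z + j))
      simp only [Finset.mul_sum, mul_zero] at h
      rw [← h]
      refine Finset.sum_congr rfl fun i _ => ?_
      rw [show z + i + j = z + j + i by ring]
      ring
    · refine Eq.trans (Finset.sum_congr rfl fun i _ => ?_) (hrec' n)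
      have h1 := hca (n + i)
      have h2 := hca' (n + i)
      push_cast at h1 h2
      rw [h1, h2]
  have := eq_zero_of_recurrence (d := d') hq' (f := fun z => c z - c' z) (fun z => ?_) fun n => ?_
  · funext z
    exact sub_eq_zero.1 (congrFun this z)
  · simp only [mul_sub, Finset.sum_sub_distrib]
    rw [hrec' z, sub_zero]
    exact congrFun hf z
  · simp only [hca, hca', sub_self]

/-- By the Cayley–Hamilton theorem, the entries of the integer powers of an invertible matrix form a
two-sided recurrent sequence. -/
lemma isRecurrentExtension_zpow {ι : Type*} [Fintype ι] [DecidableEq ι] {A : Matrix ι ι ℚ}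
    (hA : IsUnit A.det) (x y : ι) :
    IsRecurrentExtension (fun n => (A ^ n) x y) fun z => (A ^ z) x y := by
  refine ⟨fun n => by simp only [zpow_natCast], A.charpoly.natDegree, A.charpoly.coeff,
    fun h => ?_, ?_, fun z => ?_⟩
  · rw [Matrix.det_eq_sign_charpoly_coeff, h, mul_zero] at hA
    exact not_isUnit_zero hA
  · exact A.charpoly_monic.leadingCoeff.trans_ne one_ne_zero
  · have h := congrArg (A ^ z * ·) (A.aeval_self_charpoly)
    simp only [Polynomial.aeval_eq_sum_range, Finset.mul_sum, mul_zero] at h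
    have h' := congrFun (congrFun h x) y
    rw [Matrix.sum_apply] at h'
    refine Eq.trans (Finset.sum_congr rfl fun i _ => ?_) h'
    beta_reduce
    rw [Matrix.zpow_add hA, zpow_natCast, mul_smul_comm, Matrix.smul_apply, smul_eq_mul]

/-! ### The two Gram matrices of the bidiagonal matrix -/

lemma det_bidiag (N : ℕ) : (bidiag N).det = 1 := by
  rw [Matrix.det_of_isLowerTriangular]
  · simp [bidiag]
  · intro a b hab
    have : (a : ℕ) < b := hab
    simp only [bidiag, Matrix.of_apply, Fin.ext_iff]
    exact if_neg (by omega)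

/-- The matrix of two-step walks on the path `0 - 1 - ⋯ - (2N - 1)` between even vertices. -/
def evenGram (N : ℕ) : Matrix (Fin N) (Fin N) ℚ := bidiag N * (bidiag N).transpose

/-- The matrix of two-step walks on the path `0 - 1 - ⋯ - (2N - 1)` between odd vertices. -/
def oddGram (N : ℕ) : Matrix (Fin N) (Fin N) ℚ := (bidiag N).transpose * bidiag N

lemma det_evenGram (N : ℕ) : (evenGram N).det = 1 := by
  simp [evenGram, det_bidiag]

lemma det_oddGram (N : ℕ) : (oddGram N).det = 1 := by
  simp [oddGram, det_bidiag]

lemma pathAdj_sq (N : ℕ) : pathAdj N ^ 2 = Matrix.fromBlocks (evenGram N) 0 0 (oddGram N) := by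
  simp [pathAdj, sq, Matrix.fromBlocks_multiply, evenGram, oddGram]

lemma isUnit_det_pathAdj (N : ℕ) : IsUnit (pathAdj N).det := by
  have h : (pathAdj N ^ 2).det = 1 := by
    rw [pathAdj_sq, Matrix.det_fromBlocks_zero₂₁, det_evenGram, det_oddGram, one_mul]
  rw [Matrix.det_pow] at h
  exact IsUnit.of_pow_eq_one h two_ne_zero

lemma fromBlocks_diagonal_zpow {ι κ : Type*} [Fintype ι] [Fintype κ] [DecidableEq ι]
    [DecidableEq κ] {A : Matrix ι ι ℚ} {D : Matrix κ κ ℚ} (hA : IsUnit A.det) (hD : IsUnit D.det)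
    (z : ℤ) : Matrix.fromBlocks A 0 0 D ^ z = Matrix.fromBlocks (A ^ z) 0 0 (D ^ z) := by
  have hAD : IsUnit (Matrix.fromBlocks A 0 0 D).det := by
    rw [Matrix.det_fromBlocks_zero₂₁]
    exact hA.mul hD
  obtain ⟨n, rfl | rfl⟩ := z.eq_nat_or_neg
  · simp only [zpow_natCast, Matrix.fromBlocks_diagonal_pow]
  · simp only [Matrix.zpow_neg_natCast, Matrix.fromBlocks_diagonal_pow]
    refine Matrix.inv_eq_right_inv ?_
    rw [Matrix.fromBlocks_multiply, Matrix.mul_nonsing_inv _ (by simpa using hA.pow n),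
      Matrix.mul_nonsing_inv _ (by simpa using hD.pow n)]
    simp

lemma pathAdj_zpow_two_mul {N : ℕ} (z : ℤ) (a b : Fin N) :
    (pathAdj N ^ (2 * z)) (Sum.inl a) (Sum.inl b) = (evenGram N ^ z) a b := by
  rw [Matrix.zpow_mul _ (isUnit_det_pathAdj N),
    show pathAdj N ^ (2 : ℤ) = pathAdj N ^ 2 from zpow_natCast _ 2, pathAdj_sq,
    fromBlocks_diagonal_zpow (by simp [det_evenGram]) (by simp [det_oddGram]),
    Matrix.fromBlocks_apply₁₁]

/-- A closed walk at the end `0` of the path graph passes through the vertex `1` after the first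
and before the last step. -/
lemma evenGram_zpow_add_one {N : ℕ} [NeZero N] (z : ℤ) :
    (evenGram N ^ (z + 1)) 0 0 = (oddGram N ^ z) 0 0 := by
  have hs : SemiconjBy (bidiag N) (oddGram N) (evenGram N) := by
    simp only [SemiconjBy, oddGram, evenGram, Matrix.mul_assoc]
  have hz : bidiag N * oddGram N ^ z = evenGram N ^ z * bidiag N :=
    Matrix.SemiconjBy.zpow_right (by simp [det_oddGram]) (by simp [det_evenGram]) hs z
  have hrow : ∀ b : Fin N, bidiag N 0 b = if 0 = b then 1 else 0 := fun b => by
    simp [bidiag]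
  have hfac : evenGram N ^ (z + 1) = bidiag N * oddGram N ^ z * (bidiag N).transpose := by
    rw [Matrix.zpow_add_one (by simp [det_evenGram]), hz, Matrix.mul_assoc, evenGram]
  rw [hfac]
  simp [Matrix.mul_apply, hrow]

lemma bidiag_rev {N : ℕ} (a b : Fin N) : bidiag N a.rev b.rev = bidiag N b a := by
  simp only [bidiag, Matrix.of_apply, Fin.ext_iff, Fin.val_rev]
  congr 1
  simp only [eq_iff_iff]
  omega

lemma evenGram_submatrix_rev (N : ℕ) :
    (evenGram N).submatrix Fin.revPerm Fin.revPerm = oddGram N := by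
  rw [evenGram, ← Matrix.submatrix_mul_equiv _ _ _ Fin.revPerm]
  have h : (bidiag N).submatrix Fin.revPerm Fin.revPerm = (bidiag N).transpose := by
    ext a b
    exact bidiag_rev a b
  rw [← Matrix.transpose_submatrix, h, Matrix.transpose_transpose, oddGram]

/-- The reflection of the path graph exchanges even and odd vertices. -/
lemma oddGram_zpow_apply {N : ℕ} (z : ℤ) (a b : Fin N) :
    (oddGram N ^ z) a b = (evenGram N ^ z) a.rev b.rev := by
  have hpow : ∀ n : ℕ, oddGram N ^ n = (evenGram N ^ n).submatrix Fin.revPerm Fin.revPerm := by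
    intro n
    induction n with
    | zero => simp
    | succ n ih =>
      rw [pow_succ, pow_succ, ih, ← Matrix.submatrix_mul_equiv _ _ _ Fin.revPerm,
        evenGram_submatrix_rev]
  obtain ⟨n, rfl | rfl⟩ := z.eq_nat_or_neg
  · simp only [zpow_natCast, hpow]
    rfl
  · simp only [Matrix.zpow_neg_natCast, hpow, Matrix.inv_submatrix_equiv]
    rfl

lemma bidiag_apply_eq_zero {N : ℕ} {a b : Fin N} (h : (b : ℕ) + 1 < a) (c : Fin N) :
    bidiag N a c * bidiag N b c = 0 := by
  simp only [bidiag, Matrix.of_apply, Fin.ext_iff]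
  split_ifs <;> first | omega | simp

lemma evenGram_apply_eq_zero {N : ℕ} {a b : Fin N} (h : (b : ℕ) + 1 < a) :
    evenGram N a b = 0 := by
  simp only [evenGram, Matrix.mul_apply, Matrix.transpose_apply]
  exact Finset.sum_eq_zero fun c _ => bidiag_apply_eq_zero h c

lemma evenGram_apply_eq_one {N : ℕ} {a b : Fin N} (h : (a : ℕ) = b + 1) :
    evenGram N a b = 1 := by
  simp only [evenGram, Matrix.mul_apply, Matrix.transpose_apply]
  rw [Finset.sum_eq_single b]
  · simp [bidiag, h]
  · intro c _ hc
    simp only [bidiag, Matrix.of_apply, Fin.ext_iff] at hc ⊢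
    split_ifs <;> first | omega | simp
  · simp

lemma evenGram_isSymm (N : ℕ) : (evenGram N).IsSymm := by
  simp [evenGram, Matrix.IsSymm, Matrix.transpose_mul]

lemma oddGram_isSymm (N : ℕ) : (oddGram N).IsSymm := by
  simp [oddGram, Matrix.IsSymm, Matrix.transpose_mul]

lemma oddGram_apply {N : ℕ} (a b : Fin N) : oddGram N a b = evenGram N b.rev a.rev := by
  rw [(evenGram_isSymm N).apply, ← evenGram_submatrix_rev]
  rfl

/-! ### Hankel determinants and complementary minors -/

lemma pow_apply_zero_eq_zero {N : ℕ} [NeZero N] {T : Matrix (Fin N) (Fin N) ℚ}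
    (h0 : ∀ a b : Fin N, (b : ℕ) + 1 < a → T a b = 0) {i : ℕ} {a : Fin N} (ha : i < (a : ℕ)) :
    (T ^ i) a 0 = 0 := by
  induction i generalizing a with
  | zero => rw [pow_zero, Matrix.one_apply_ne]; rintro rfl; simp at ha
  | succ i ih =>
    rw [pow_succ', Matrix.mul_apply]
    refine Finset.sum_eq_zero fun b _ => ?_
    rcases Nat.lt_or_ge i b with hb | hb
    · rw [ih hb, mul_zero]
    · rw [h0 a b (by omega), zero_mul]

lemma pow_apply_zero_eq_one {N : ℕ} [NeZero N] {T : Matrix (Fin N) (Fin N) ℚ}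
    (h0 : ∀ a b : Fin N, (b : ℕ) + 1 < a → T a b = 0)
    (h1 : ∀ a b : Fin N, (a : ℕ) = b + 1 → T a b = 1) {i : ℕ} {a : Fin N} (ha : (a : ℕ) = i) :
    (T ^ i) a 0 = 1 := by
  induction i generalizing a with
  | zero =>
    have : a = 0 := Fin.ext (by simpa using ha)
    simp [this]
  | succ i ih =>
    rw [pow_succ', Matrix.mul_apply, Finset.sum_eq_single (⟨i, by omega⟩ : Fin N)]
    · rw [ih rfl, h1 _ _ ha, one_mul]
    · intro b _ hb
      rcases Nat.lt_or_ge i b with hb' | hb'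
      · rw [pow_apply_zero_eq_zero h0 hb', mul_zero]
      · rw [h0 a b, zero_mul]
        have : (b : ℕ) ≠ i := fun h => hb (Fin.ext h)
        omega
    · simp

/-- A Hankel determinant of the moments `(T ^ z) 0 0` of a symmetric tridiagonal matrix `T` with
ones next to the diagonal is a leading principal minor of a power of `T`: the first `k` vectors
`T ^ i e₀` are expressed by a unitriangular matrix in the first `k` unit vectors. -/
lemma det_hankel_zpow {N : ℕ} [NeZero N] {T : Matrix (Fin N) (Fin N) ℚ} (hT : T.IsSymm)
    (hdet : IsUnit T.det) (h0 : ∀ a b : Fin N, (b : ℕ) + 1 < a → T a b = 0)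
    (h1 : ∀ a b : Fin N, (a : ℕ) = b + 1 → T a b = 1) {k : ℕ} (hk : k ≤ N) (p : ℤ) :
    (Matrix.of fun i j : Fin k => (T ^ (p + (i : ℕ) + (j : ℕ))) 0 0).det =
      ((T ^ p).submatrix (Fin.castLE hk) (Fin.castLE hk)).det := by
  set V : Matrix (Fin k) (Fin k) ℚ := Matrix.of fun a i => (T ^ (i : ℕ)) (Fin.castLE hk a) 0 with hV
  have hVdet : V.det = 1 := by
    rw [Matrix.det_of_isUpperTriangular]
    · exact Finset.prod_eq_one fun i _ => pow_apply_zero_eq_one h0 h1 rfl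
    · intro a i hai
      exact pow_apply_zero_eq_zero h0 hai
  have hout : ∀ (i : Fin k) (a : Fin N), a ∉ Set.range (Fin.castLE hk) →
      (T ^ (i : ℕ)) a 0 = 0 := by
    intro i a ha
    refine pow_apply_zero_eq_zero h0 ?_
    by_contra hlt
    exact ha ⟨⟨a, by omega⟩, rfl⟩
  have hprod : (Matrix.of fun i j : Fin k => (T ^ (p + (i : ℕ) + (j : ℕ))) 0 0) =
      V.transpose * (T ^ p).submatrix (Fin.castLE hk) (Fin.castLE hk) * V := by
    ext i j
    rw [Matrix.of_apply, add_comm p, Matrix.zpow_add hdet, Matrix.zpow_add hdet, zpow_natCast,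
      zpow_natCast, Matrix.mul_apply, Matrix.mul_apply]
    symm
    refine Fintype.sum_of_injective (Fin.castLE hk) (Fin.castLE_injective hk) _ _
      (fun b hb => by rw [hout j b hb, mul_zero]) fun b => ?_
    rw [Matrix.mul_apply, Matrix.mul_apply, hV, Matrix.of_apply]
    congr 1
    refine Fintype.sum_of_injective (Fin.castLE hk) (Fin.castLE_injective hk) _ _
      (fun a ha => ?_) fun a => ?_
    · rw [(hT.pow i).apply, hout i a ha, zero_mul]
    · rw [(hT.pow i).apply]
      rfl
  rw [hprod, Matrix.det_mul, Matrix.det_mul, Matrix.det_transpose, hVdet, one_mul, mul_one]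

/-- Jacobi's identity for complementary principal minors of a matrix and its inverse. -/
lemma det_toBlocks₁₁_of_mul_eq_one {ι κ : Type*} [Fintype ι] [Fintype κ] [DecidableEq ι]
    [DecidableEq κ] {M M' : Matrix (ι ⊕ κ) (ι ⊕ κ) ℚ} (h : M * M' = 1) :
    M.toBlocks₁₁.det = M.det * M'.toBlocks₂₂.det := by
  have hblock : M * Matrix.fromBlocks 1 M'.toBlocks₁₂ 0 M'.toBlocks₂₂ =
      Matrix.fromBlocks M.toBlocks₁₁ 0 M.toBlocks₂₁ 1 := by
    rw [← Matrix.fromBlocks_toBlocks M, ← Matrix.fromBlocks_toBlocks M',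
      Matrix.fromBlocks_multiply, ← Matrix.fromBlocks_one, Matrix.fromBlocks_inj] at h
    conv_lhs => rw [← Matrix.fromBlocks_toBlocks M]
    rw [Matrix.fromBlocks_multiply, h.2.1, h.2.2.2]
    simp
  have hdet := congrArg Matrix.det hblock
  rw [Matrix.det_mul, Matrix.det_fromBlocks_zero₂₁, Matrix.det_fromBlocks_zero₁₂] at hdet
  simpa using hdet.symm

lemma det_castLE_minor_evenGram {k m : ℕ} (p : ℤ) :
    ((evenGram (k + m) ^ p).submatrix (Fin.castLE (Nat.le_add_right k m))
        (Fin.castLE (Nat.le_add_right k m))).det =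
      ((oddGram (k + m) ^ (-p)).submatrix (Fin.castLE (Nat.le_add_left m k))
        (Fin.castLE (Nat.le_add_left m k))).det := by
  have hB : IsUnit (evenGram (k + m)).det := by simp [det_evenGram]
  set e : Fin k ⊕ Fin m ≃ Fin (k + m) := finSumFinEquiv
  have hJ := det_toBlocks₁₁_of_mul_eq_one (M := (evenGram (k + m) ^ p).submatrix e e)
    (M' := (evenGram (k + m) ^ (-p)).submatrix e e) (by
      rw [Matrix.submatrix_mul_equiv, ← Matrix.zpow_add hB, add_neg_cancel, zpow_zero,
        Matrix.submatrix_one_equiv])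
  have hdet : (evenGram (k + m) ^ p).det = 1 := by
    obtain ⟨n, rfl | rfl⟩ := p.eq_nat_or_neg
    · simp [det_evenGram]
    · simp [Matrix.zpow_neg_natCast, Matrix.det_nonsing_inv, det_evenGram]
  rw [Matrix.det_submatrix_equiv_self, hdet, one_mul] at hJ
  refine (Eq.trans ?_ hJ).trans ?_
  · rfl
  · rw [← Matrix.det_submatrix_equiv_self Fin.revPerm]
    congr 1
    ext i j
    rw [Matrix.submatrix_apply, Matrix.submatrix_apply, oddGram_zpow_apply]
    have : ∀ i : Fin m, e (Sum.inr (Fin.revPerm i)) = (Fin.castLE (Nat.le_add_left m k) i).rev := by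
      intro i
      ext
      simp [e, Fin.val_rev]
      omega
    rw [← this, ← this]
    rfl

/-! ### The reciprocity -/

theorem theorem15 (n k m : ℕ) :
    (∃! C : ℤ → ℚ, IsRecurrentExtension (fun l => (dyckCount (2 * k + 2 * m - 1) l : ℚ)) C) ∧
    ∀ C : ℤ → ℚ, IsRecurrentExtension (fun l => (dyckCount (2 * k + 2 * m - 1) l : ℚ)) C →
      (Matrix.of fun i j : Fin k =>
          C (2 * (n : ℤ) + 2 * (i : ℕ) + 2 * (j : ℕ) + 4 * (m : ℤ) - 2)).det =
        (Matrix.of fun i j : Fin m => C (-2 * (n : ℤ) - 2 * (i : ℕ) - 2 * (j : ℕ))).det := by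
  rcases Nat.eq_zero_or_pos (k + m) with hkm | hkm
  · -- The strip is empty: all counts are zero, and both determinants are of size zero.
    obtain ⟨rfl, rfl⟩ : k = 0 ∧ m = 0 := by omega
    refine ⟨⟨0, ⟨fun l => ?_, 0, 1, one_ne_zero, one_ne_zero, by simp⟩, fun C hC => hC.unique
      ⟨fun l => ?_, 0, 1, one_ne_zero, one_ne_zero, by simp⟩⟩, fun C _ => by simp⟩ <;>
    simp [dyckCount, boundedPaths_eq_empty (show ¬ ((0 : ℤ) ≤ 0 ∧ (0 : ℤ) ≤ -1) by omega)]
  have : NeZero (k + m) := ⟨hkm.ne'⟩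
  have hcount : (fun l => (dyckCount (2 * k + 2 * m - 1) l : ℚ)) =
      fun l => (pathAdj (k + m) ^ l) (Sum.inl 0) (Sum.inl 0) := by
    funext l
    rw [pathAdj_pow_apply, dyckCount]
    simp [height, mul_add]
  have hext := isRecurrentExtension_zpow (isUnit_det_pathAdj (k + m)) (Sum.inl 0) (Sum.inl 0)
  rw [hcount]
  refine ⟨⟨_, hext, fun C hC => hC.unique hext⟩, fun C hC => ?_⟩
  have heven : ∀ w z : ℤ, w = 2 * z → C w = (evenGram (k + m) ^ z) 0 0 := by
    rintro w z rfl
    rw [hC.unique hext]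
    exact pathAdj_zpow_two_mul z 0 0
  set p : ℤ := n + 2 * m - 1 with hp
  calc (Matrix.of fun i j : Fin k =>
          C (2 * (n : ℤ) + 2 * (i : ℕ) + 2 * (j : ℕ) + 4 * (m : ℤ) - 2)).det
      = (Matrix.of fun i j : Fin k =>
          (evenGram (k + m) ^ (p + (i : ℕ) + (j : ℕ))) 0 0).det := by
        congr 1
        ext i j
        exact heven _ _ (by rw [hp]; ring)
    _ = ((evenGram (k + m) ^ p).submatrix (Fin.castLE (Nat.le_add_right k m))
          (Fin.castLE (Nat.le_add_right k m))).det :=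
        det_hankel_zpow (evenGram_isSymm _) (by simp [det_evenGram])
          (fun _ _ h => evenGram_apply_eq_zero h) (fun _ _ h => evenGram_apply_eq_one h) _ p
    _ = ((oddGram (k + m) ^ (-p)).submatrix (Fin.castLE (Nat.le_add_left m k))
          (Fin.castLE (Nat.le_add_left m k))).det := det_castLE_minor_evenGram p
    _ = (Matrix.of fun i j : Fin m =>
          (oddGram (k + m) ^ (-p + (i : ℕ) + (j : ℕ))) 0 0).det := by
        refine (det_hankel_zpow (oddGram_isSymm _) (by simp [det_oddGram])
          (fun a b h => ?_) (fun a b h => ?_) _ (-p)).symm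
        · rw [oddGram_apply]
          exact evenGram_apply_eq_zero (by simp only [Fin.val_rev]; omega)
        · rw [oddGram_apply]
          exact evenGram_apply_eq_one (by simp only [Fin.val_rev]; omega)
    _ = (Matrix.of fun i j : Fin m => C (-2 * (n : ℤ) - 2 * (i : ℕ) - 2 * (j : ℕ))).det := by
        -- Reversing rows and columns turns the exponents `-p + i + j` into `-n - 1 - i - j`.
        rw [← Matrix.det_submatrix_equiv_self Fin.revPerm]
        congr 1
        ext i j
        have hi : ((i.rev : ℕ) : ℤ) = m - 1 - (i : ℕ) := by rw [Fin.val_rev]; omega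
        have hj : ((j.rev : ℕ) : ℤ) = m - 1 - (j : ℕ) := by rw [Fin.val_rev]; omega
        simp only [Matrix.submatrix_apply, Matrix.of_apply, Fin.revPerm_apply]
        rw [← evenGram_zpow_add_one]
        exact (heven _ _ (by rw [hi, hj, hp]; ring)).symm
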